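/- Consider the firefighter problem on a finite simple graph $G=(V,E)$. A fire breaks out at a vertex $v\in V$. In each subsequent turn the firefighter protects one vertex that is not on fire, and then the fire spreads to all unprotected neighbours of the vertices on fire; vertices that are protected or on fire stay so forever. The game stops when every neighbour of a vertex on fire is on fire or protected. Let $\mathrm{sn}(G,v)$ be the maximum number of vertices that the firefighter can save (that is, that never catch fire), and let the surviving rate of $G$ be $$\rho(G)=\frac1{|V|}\sum_{v\in V}\frac{\mathrm{sn}(G,v)}{|V|}.$$ Let $P_n\,\square\,P_n$ be the Cartesian product of two paths on $n$ vertices. Then, as $n\to\infty$, $$\frac58+o(1)\;\le\;\rho(P_n\,\square\,P_n)\;\le\;\frac{67243}{105300}+o(1),$$ and the right-hand side is smaller than $0.6386$ for all sufficiently large $n$. -/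

import Mathlib

open Filter Topology

namespace Firefighter

variable {V : Type*}

/-- The set of vertices protected in the first `t` turns, if the firefighter protects `p i` in the
turn number `i + 1`. -/
def protectedSet (p : ℕ → V) (t : ℕ) : Set V := {u | ∃ i < t, p i = u}

/-- The set of vertices on fire at the end of turn `t`, if the fire breaks out at `v` and the
firefighter protects `p 0, p 1, p 2, …` in this order. In each turn the firefighter acts first; then
the fire spreads to all unprotected neighbours of the vertices on fire. -/
def burning (G : SimpleGraph V) (v : V) (p : ℕ → V) : ℕ → Set V
  | 0 => {v}
  | t + 1 => burning G v p t ∪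
      {u | u ∉ protectedSet p (t + 1) ∧ ∃ w ∈ burning G v p t, G.Adj w u}

/-- The game has stopped after `t` turns: every neighbour of a vertex on fire is on fire
or protected. -/
def Stopped (G : SimpleGraph V) (v : V) (p : ℕ → V) (t : ℕ) : Prop :=
  ∀ w ∈ burning G v p t, ∀ u, G.Adj w u → u ∈ burning G v p t ∨ u ∈ protectedSet p t

/-- As long as the game goes on, the vertex protected in the next turn is not on fire. (The fire
is deterministic, so a strategy is the sequence of protected vertices. The terms of `p` after the
game has stopped have no effect.) -/
def Legal (G : SimpleGraph V) (v : V) (p : ℕ → V) : Prop :=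
  ∀ t, ¬ Stopped G v p t → p t ∉ burning G v p t

/-- The set of vertices that never catch fire. -/
def saved (G : SimpleGraph V) (v : V) (p : ℕ → V) : Set V := {u | ∀ t, u ∉ burning G v p t}

/-- `sn(G, v)`: the largest number of vertices that the firefighter can save when the fire breaks
out at `v` (used for finite graphs, where the set below is nonempty and bounded). -/
noncomputable def sn (G : SimpleGraph V) (v : V) : ℕ :=
  sSup {k | ∃ p : ℕ → V, Legal G v p ∧ (saved G v p).ncard = k}

/-- `ρ(G, v)`: the largest proportion of vertices that can be saved. -/
noncomputable def survivingRateAt [Fintype V] (G : SimpleGraph V) (v : V) : ℝ :=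
  (sn G v : ℝ) / (Fintype.card V : ℝ)

/-- The surviving rate `ρ(G)`: the expectation of `ρ(G, v)` for a uniformly random vertex `v`. -/
noncomputable def survivingRate [Fintype V] (G : SimpleGraph V) : ℝ :=
  (∑ v, survivingRateAt G v) / (Fintype.card V : ℝ)

/-- The square grid `P_n □ P_n`, where `P_n` is the path on `n` vertices. -/
def squareGrid (n : ℕ) : SimpleGraph (Fin n × Fin n) :=
  SimpleGraph.boxProd (SimpleGraph.pathGraph n) (SimpleGraph.pathGraph n)

end Firefighter

namespace Firefighter

variable {V : Type*}

/-! Lower bound: the firefighter builds a barrier across all columns, one vertex per column, with a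
V-shaped bend over the origin of the fire, and saves everything on or beyond it. The bend gives time
to alternate between the two sides until the nearer side is closed; then the far side needs only a
horizontal wall (`le_sn_of_left`). Choosing the best of the eight symmetric positions gives the
density 1 - x - y + max(x, y)² in terms of the distances x, y to the sides, whose mean is 5/8.

Upper bound: split the grid into four quadrants around the origin of the fire and follow the layers
at distance t at time t. An unburnt, unprotected vertex has all its predecessors unburnt, so within
a quadrant the unburnt part of a layer grows only through protected vertices; hence at most t
vertices of layer t are unburnt. Past a distance B exceeding all side lengths, an unburnt set also
shrinks by one per step unless protection makes up for it (`Shadow.diagCount_succ_le_sub_one`).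
Balancing vertices protected early against those protected late gives at most B unburnt vertices per
layer on average for K further layers (`QuadrantCover.sum_unburnt_le`); beyond that every vertex is
conceded. With B = n - m and K about 2m/3, where m is the distance to the boundary, averaging yields
7/16 + 4 · (1/2) · (1/10) = 51/80, which is below 67243/105300. -/

/-! ### Invariance of the game under isomorphisms; symmetries of the grid -/

lemma burning_iso {W : Type*} {G : SimpleGraph V} {H : SimpleGraph W} (φ : G ≃g H) (v : V)
    (p : ℕ → V) (t : ℕ) (u : V) :
    φ u ∈ burning H (φ v) (φ ∘ p) t ↔ u ∈ burning G v p t := by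
  induction t generalizing u with
  | zero => simp [burning]
  | succ t ih =>
    simp only [burning, Set.mem_union, Set.mem_ofPred_eq, ih, protectedSet, Function.comp,
      φ.injective.eq_iff]
    refine or_congr Iff.rfl (and_congr Iff.rfl ⟨?_, ?_⟩)
    · rintro ⟨w, hw, hadj⟩
      obtain ⟨w, rfl⟩ := φ.surjective w
      exact ⟨w, (ih w).1 hw, φ.map_adj_iff.1 hadj⟩
    · rintro ⟨w, hw, hadj⟩
      exact ⟨φ w, (ih w).2 hw, φ.map_adj_iff.2 hadj⟩

lemma ncard_saved_iso {W : Type*} {G : SimpleGraph V} {H : SimpleGraph W} (φ : G ≃g H) (v : V)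
    (p : ℕ → V) : (saved H (φ v) (φ ∘ p)).ncard = (saved G v p).ncard := by
  rw [← Set.ncard_image_of_injective (saved G v p) φ.injective]
  congr 1
  ext w
  obtain ⟨w, rfl⟩ := φ.surjective w
  simp [saved, burning_iso]

lemma Legal.iso {W : Type*} {G : SimpleGraph V} {H : SimpleGraph W} (φ : G ≃g H) {v : V}
    {p : ℕ → V} (hp : Legal G v p) : Legal H (φ v) (φ ∘ p) := by
  intro t ht hb
  refine hp t (fun hs => ht ?_) ((burning_iso φ v p t (p t)).1 hb)
  intro w hw u hadj
  obtain ⟨w, rfl⟩ := φ.surjective w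
  obtain ⟨u, rfl⟩ := φ.surjective u
  rw [burning_iso] at hw ⊢
  simpa [protectedSet] using hs w hw u (φ.map_adj_iff.1 hadj)

lemma ncard_saved_le_sn [Finite V] {G : SimpleGraph V} {v : V} {p : ℕ → V} (hp : Legal G v p) :
    (saved G v p).ncard ≤ sn G v := by
  refine le_csSup ⟨Nat.card V, ?_⟩ ⟨p, hp, rfl⟩
  rintro k ⟨p, -, rfl⟩
  exact Set.ncard_le_card _

lemma sn_le_sn_iso [Finite V] {G : SimpleGraph V} (φ : G ≃g G) (v : V) :
    sn G v ≤ sn G (φ v) := by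
  refine csSup_le' ?_
  rintro k ⟨p, hp, rfl⟩
  rw [← ncard_saved_iso φ]
  exact ncard_saved_le_sn (hp.iso φ)

lemma squareGrid_adj {n : ℕ} {u w : Fin n × Fin n} : (squareGrid n).Adj u w ↔
    (((u.1 : ℕ) + 1 = w.1 ∨ (w.1 : ℕ) + 1 = u.1) ∧ u.2 = w.2) ∨
    (((u.2 : ℕ) + 1 = w.2 ∨ (w.2 : ℕ) + 1 = u.2) ∧ u.1 = w.1) := by
  rw [squareGrid, SimpleGraph.boxProd_adj, SimpleGraph.pathGraph_adj, SimpleGraph.pathGraph_adj]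

/-- Transposition of the square grid. -/
def gridSwap (n : ℕ) : squareGrid n ≃g squareGrid n where
  toEquiv := Equiv.prodComm _ _
  map_rel_iff' := by
    intro u w
    simp only [squareGrid_adj, Equiv.prodComm_apply, Prod.fst_swap, Prod.snd_swap]
    tauto

/-- Reflection of the first coordinate of the square grid. -/
def gridRev (n : ℕ) : squareGrid n ≃g squareGrid n where
  toEquiv := Fin.revPerm.prodCongr (Equiv.refl _)
  map_rel_iff' := by
    rintro ⟨⟨a, ha⟩, b⟩ ⟨⟨c, hc⟩, d⟩
    simp only [squareGrid_adj, Equiv.prodCongr_apply, Prod.map_apply, Fin.revPerm_apply,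
      Equiv.refl_apply, Fin.ext_iff, Fin.val_rev]
    omega

/-! ### Lower bound: barriers -/

/-- If a barrier `H` of slope at most one is built in time, the vertices above it are saved. -/
lemma le_sn_of_barrier {n : ℕ} (v : Fin n × Fin n) (H idx : ℕ → ℕ) (hv : (v.2 : ℕ) + 1 = H v.1)
    (hvn : H v.1 < n) (hH : ∀ i < n, ∀ k < n, k ≤ i + 1 → i ≤ k + 1 → H i ≤ H k + 1)
    (hinj : ∀ i < n, ∀ k < n, idx i = idx k → i = k)
    (hidx : ∀ i < n, idx i + 1 ≤ ((i : ℤ) - v.1).natAbs + ((H i : ℤ) - v.2).natAbs) :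
    n * n ≤ sn (squareGrid n) v + ∑ i ∈ Finset.range n, H i := by
  classical
  -- Turn `idx i` builds the barrier in column `i`, unless the barrier leaves the grid there. Idle
  -- turns use the barrier vertex above `v`: every move lies on the barrier, which never burns, so
  -- legality is automatic.
  let q : ℕ → Fin n × Fin n := fun t =>
    if h : ∃ i : Fin n, idx i = t ∧ H i < n then (h.choose, ⟨H h.choose, h.choose_spec.2⟩)
    else (v.1, ⟨H v.1, hvn⟩)
  have hq : ∀ t, ((q t).2 : ℕ) = H (q t).1 := by
    intro t
    by_cases h : ∃ i : Fin n, idx i = t ∧ H i < n <;> simp [q, h]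
  have hqi : ∀ i : Fin n, ∀ hi : H i < n, q (idx i) = (i, ⟨H i, hi⟩) := by
    intro i hi
    have h : ∃ k : Fin n, idx k = idx i ∧ H k < n := ⟨i, rfl, hi⟩
    have : h.choose = i :=
      Fin.ext (hinj _ h.choose.2 _ i.2 h.choose_spec.1)
    simp only [q, h, dif_pos]
    simp [this]
  have key : ∀ t, ∀ u ∈ burning (squareGrid n) v q t,
      (u.2 : ℕ) < H u.1 ∧ ((u.1 : ℤ) - v.1).natAbs + ((u.2 : ℤ) - v.2).natAbs ≤ t := by
    intro t
    induction t with
    | zero =>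
      intro u hu
      have : u = v := hu
      rw [this, ← hv]
      simp
    | succ t ih =>
      rintro u (hu | ⟨hu, w, hw, hadj⟩)
      · have := ih u hu
        exact ⟨this.1, by omega⟩
      · obtain ⟨h1, h2⟩ := ih w hw
        rw [squareGrid_adj, Fin.ext_iff, Fin.ext_iff] at hadj
        have hd : ((u.1 : ℤ) - v.1).natAbs + ((u.2 : ℤ) - v.2).natAbs ≤ t + 1 := by
          omega
        have hle : (u.2 : ℕ) ≤ H u.1 := by
          rcases hadj with h | h
          · have := hH w.1 w.1.2 u.1 u.1.2 (by omega) (by omega)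
            omega
          · rw [← h.2]; omega
        -- The slope condition lets the fire rise at most to the barrier itself. A barrier vertex
        -- reached in this turn has distance at most `t + 1` from `v`, so by `hidx` it is already
        -- protected.
        refine ⟨lt_of_le_of_ne hle fun he => hu ?_, hd⟩
        have hlt : H u.1 < n := he ▸ u.2.2
        refine ⟨idx u.1, ?_, ?_⟩
        · have := hidx u.1 u.1.2
          rw [← he] at this
          omega
        · rw [hqi u.1 hlt]
          exact Prod.ext rfl (Fin.ext he.symm)
  have hlegal : Legal (squareGrid n) v q := fun t _ hb => by
    have := (key t _ hb).1
    rw [hq t] at this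
    exact lt_irrefl _ this
  refine le_trans ?_ (Nat.add_le_add_right (ncard_saved_le_sn hlegal) _)
  let F : Finset (Fin n × Fin n) := Finset.univ.filter fun u => (u.2 : ℕ) < H u.1
  have hsub : ((F : Finset (Fin n × Fin n)) : Set (Fin n × Fin n))ᶜ ⊆ saved (squareGrid n) v q :=
    fun u hu t hb => hu (by simpa [F] using (key t u hb).1)
  have hF : F.card ≤ ∑ i ∈ Finset.range n, H i := by
    rw [← Fin.sum_univ_eq_sum_range, Finset.card_filter, Fintype.sum_prod_type]
    refine Finset.sum_le_sum fun i _ => ?_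
    rw [← Finset.card_filter]
    calc _ ≤ (Finset.range (H i)).card := Finset.card_le_card_of_injOn (fun j : Fin n => (j : ℕ))
            (fun j hj => by simpa using hj) (fun a _ b _ h => Fin.ext h)
      _ = H i := Finset.card_range _
  have h1 := Set.ncard_le_ncard hsub
  have h2 := Set.ncard_add_ncard_compl (F : Set (Fin n × Fin n))
  rw [Set.ncard_coe_finset] at h2
  simp only [Nat.card_eq_fintype_card, Fintype.card_prod, Fintype.card_fin] at h2
  omega

/-- The barrier rises with slope one on both sides of `v` up to horizontal distance `a = v.1`, then
stays level; the unprotected region below it has the stated size. -/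
lemma le_sn_of_left {n : ℕ} (v : Fin n × Fin n) (hv : 2 * (v.1 : ℕ) < n) :
    n * n ≤ sn (squareGrid n) v + (n * (v.2 + 1) + v.1 * (n - v.1)) := by
  obtain ⟨⟨a, ha⟩, ⟨b, hb⟩⟩ := v
  simp only at hv ⊢
  rcases Nat.lt_or_ge (b + 1) n with hbn | hbn
  swap
  · have := Nat.mul_le_mul_left n hbn
    omega
  -- The column at horizontal distance `d ≤ a` has its barrier vertex at distance `2d + 1`, time
  -- enough for both sides alternately. Beyond column `2a` the left side is finished, and the
  -- distance `i + 1` suffices for one column per turn.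
  let H : ℕ → ℕ := fun i => b + 1 + min ((i : ℤ) - a).natAbs a
  let idx : ℕ → ℕ := fun i => if i < a then 2 * (a - i) - 1 else if i ≤ 2 * a then 2 * (i - a) else i
  have h := le_sn_of_barrier (⟨a, ha⟩, ⟨b, hb⟩) H idx (by simp [H]) (by simpa [H] using hbn)
    (fun i _ k _ h1 h2 => by simp only [H]; omega)
    (fun i _ k _ h => by simp only [idx] at h; split_ifs at h <;> omega)
    (fun i _ => by simp only [idx, H]; split_ifs <;> omega)
  have hs : ∀ m, a ≤ m → ∑ i ∈ Finset.range (m + a + 1), min ((i : ℤ) - a).natAbs a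
      = a * (m + 1) := by
    intro m hm
    induction m, hm using Nat.le_induction with
    | base =>
      have : ∀ c, ∑ i ∈ Finset.range (c + c + 1), ((i : ℤ) - c).natAbs = c * (c + 1) := by
        intro c
        induction c with
        | zero => simp
        | succ c ih =>
          rw [show c + 1 + (c + 1) + 1 = c + c + 1 + 1 + 1 by ring, Finset.sum_range_succ,
            Finset.sum_range_succ']
          have : ∀ i : ℕ, (((i + 1 : ℕ) : ℤ) - (c + 1 : ℕ)).natAbs = ((i : ℤ) - c).natAbs := by
            intro i; omega
          simp only [this, ih]
          have h1 : (((0 : ℕ) : ℤ) - (c + 1 : ℕ)).natAbs = c + 1 := by omega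
          have h2 : (((c + c + 1 : ℕ) : ℤ) - c).natAbs = c + 1 := by omega
          rw [h1, h2]
          ring
      rw [← this a]
      refine Finset.sum_congr rfl fun i hi => ?_
      rw [Finset.mem_range] at hi
      omega
    | succ m hm ih =>
      rw [show m + 1 + a + 1 = m + a + 1 + 1 by ring, Finset.sum_range_succ, ih]
      have : min (((m + a + 1 : ℕ) : ℤ) - a).natAbs a = a := by omega
      rw [this]
      ring
  have hsum : ∑ i ∈ Finset.range n, H i = n * (b + 1) + a * (n - a) := by
    have := hs (n - 1 - a) (by omega)
    rw [show n - 1 - a + a + 1 = n by omega, show n - 1 - a + 1 = n - a by omega] at this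
    simp only [H]
    rw [Finset.sum_add_distrib, this]
    simp
  rwa [hsum] at h

/-- The distance of a coordinate to the nearer end of the path. -/
def endDist {n : ℕ} (i : Fin n) : ℕ := min (i : ℕ) (n - 1 - i)

lemma le_sn_endDist {n : ℕ} (v : Fin n × Fin n) : n * n ≤ sn (squareGrid n) v +
    (n * (endDist v.2 + 1) + endDist v.1 * (n - endDist v.1)) := by
  have aux : ∀ v : Fin n × Fin n, n * n ≤ sn (squareGrid n) v +
      (n * (v.2 + 1) + endDist v.1 * (n - endDist v.1)) := by
    intro v
    rcases Nat.lt_or_ge (2 * (v.1 : ℕ)) n with h | h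
    · rw [show endDist v.1 = v.1 by simp only [endDist]; omega]
      exact le_sn_of_left v h
    · have h1 := le_sn_of_left (gridRev n v) (by simp [gridRev, Fin.val_rev]; omega)
      have h2 := sn_le_sn_iso (gridRev n) (gridRev n v)
      have h3 : gridRev n (gridRev n v) = v := Prod.ext (Fin.rev_rev v.1) rfl
      have h4 : endDist v.1 = ((gridRev n v).1 : ℕ) := by
        simp [gridRev, Fin.val_rev, endDist]; omega
      have h5 : (gridRev n v).2 = v.2 := rfl
      rw [h3] at h2
      rw [h5, ← h4] at h1
      omega
  rcases le_total (v.2 : ℕ) (n - 1 - v.2) with h | h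
  · rw [show endDist v.2 = v.2 by simp only [endDist]; omega]
    exact aux v
  · let φ := ((gridSwap n).trans (gridRev n)).trans (gridSwap n)
    have h1 := aux (φ v)
    have h2 := sn_le_sn_iso φ (φ v)
    have h3 : φ (φ v) = v := Prod.ext rfl (Fin.rev_rev v.2)
    have h4 : endDist v.2 = ((φ v).2 : ℕ) := by
      simp [φ, gridRev, gridSwap, Fin.val_rev, endDist]; omega
    have h5 : (φ v).1 = v.1 := rfl
    rw [h3] at h2
    rw [h5, ← h4] at h1
    omega

lemma le_sn_endDist_swap {n : ℕ} (v : Fin n × Fin n) : n * n ≤ sn (squareGrid n) v +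
    (n * (endDist v.1 + 1) + endDist v.2 * (n - endDist v.2)) :=
  (le_sn_endDist (gridSwap n v)).trans <|
    Nat.add_le_add_right (sn_le_sn_iso (gridSwap n) (gridSwap n v)) _

/-! ### Upper bound: antidiagonals of one quadrant -/

/-- First coordinates of the points `(i, t - i)` with `1 ≤ i ≤ w` and `0 ≤ t - i ≤ h`. -/
def diagIndex (w h t : ℕ) : Finset ℕ := (Finset.Icc 1 w).filter fun i => i ≤ t ∧ t ≤ i + h

lemma mem_diagIndex {w h t i : ℕ} :
    i ∈ diagIndex w h t ↔ 1 ≤ i ∧ i ≤ w ∧ i ≤ t ∧ t ≤ i + h := by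
  simp [diagIndex, and_assoc]

open Classical in
/-- The number of points `(i, j)` with `i + j = t`, `1 ≤ i ≤ w`, `0 ≤ j ≤ h` that satisfy `X`. -/
noncomputable def diagCount (w h : ℕ) (X : ℕ → ℕ → Prop) (t : ℕ) : ℕ :=
  ((diagIndex w h t).filter fun i => X i (t - i)).card

lemma diagCount_le_card (w h : ℕ) (X : ℕ → ℕ → Prop) (t : ℕ) :
    diagCount w h X t ≤ (diagIndex w h t).card := by
  classical
  exact Finset.card_filter_le _ _

lemma card_le_diagCount {w h t : ℕ} {X : ℕ → ℕ → Prop} {S : Finset ℕ} (hS : S ⊆ diagIndex w h t)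
    (hX : ∀ i ∈ S, X i (t - i)) : S.card ≤ diagCount w h X t := by
  classical
  exact Finset.card_le_card fun i hi => Finset.mem_filter.2 ⟨hS hi, hX i hi⟩

lemma card_diagIndex_le (w h t : ℕ) : (diagIndex w h t).card ≤ w + h + 1 - t := by
  have : diagIndex w h t ⊆ Finset.Icc (t - h) w := by
    intro i hi
    rw [mem_diagIndex] at hi
    rw [Finset.mem_Icc]
    omega
  refine (Finset.card_le_card this).trans ?_
  rw [Nat.card_Icc]
  omega

/-- Along antidiagonals of a rectangle, the points outside an outward-spreading fire (`X`) are
protected (`P`) or have all their predecessors outside the fire. -/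
def Shadow (w h : ℕ) (X P : ℕ → ℕ → Prop) : Prop :=
  (∀ i j, i < w → j ≤ h → X (i + 1) j → X i j ∨ P (i + 1) j) ∧
  (∀ i j, i ≤ w → j < h → X i (j + 1) → X i j ∨ P i (j + 1))

namespace Shadow

variable {w h : ℕ} {X P : ℕ → ℕ → Prop}

open Classical in
lemma diagCount_succ_le_of_card {t m : ℕ}
    (hm : ((diagIndex w h (t + 1)).filter fun i => X i (t + 1 - i) ∧ ¬ P i (t + 1 - i)).card ≤ m) :
    diagCount w h X (t + 1) ≤ m + diagCount w h P (t + 1) := by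
  refine le_trans ?_ (Nat.add_le_add_right hm _)
  unfold diagCount
  refine le_trans (Finset.card_le_card ?_) (Finset.card_union_le _ _)
  intro i hi
  simp only [Finset.mem_union, Finset.mem_filter] at hi ⊢
  tauto

lemma left (hX : Shadow w h X P) {t i : ℕ} (hi : i ∈ diagIndex w h (t + 1))
    (h1 : X i (t + 1 - i)) (h2 : ¬ P i (t + 1 - i)) : X (i - 1) (t - (i - 1)) := by
  rw [mem_diagIndex] at hi
  have := hX.1 (i - 1) (t + 1 - i) (by omega) (by omega)
  rw [show i - 1 + 1 = i by omega] at this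
  rw [show t - (i - 1) = t + 1 - i by omega]
  exact (this h1).resolve_right h2

lemma below (hX : Shadow w h X P) {t i : ℕ} (hi : i ∈ diagIndex w h (t + 1)) (hit : i ≤ t)
    (h1 : X i (t + 1 - i)) (h2 : ¬ P i (t + 1 - i)) : X i (t - i) := by
  rw [mem_diagIndex] at hi
  have := hX.2 i (t - i) (by omega) (by omega)
  rw [show t - i + 1 = t + 1 - i by omega] at this
  exact (this h1).resolve_right h2

/-- A burning point `i₀` separates the diagonal: neither of its successors can be unburnt and
unprotected, so the other such points inject into their predecessors. The axis point `i₀ = 0` is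
allowed, although it is not counted. -/
lemma diagCount_succ_le_of_exists (hX : Shadow w h X P) {t i₀ : ℕ} (hw : i₀ ≤ w) (ht : i₀ ≤ t)
    (hh : t ≤ i₀ + h) (hn : ¬ X i₀ (t - i₀)) :
    diagCount w h X (t + 1) ≤ diagCount w h X t + diagCount w h P (t + 1) := by
  classical
  refine diagCount_succ_le_of_card ?_
  have hne : ∀ i ∈ (diagIndex w h (t + 1)).filter
      (fun i => X i (t + 1 - i) ∧ ¬ P i (t + 1 - i)), i ≠ i₀ ∧ i ≠ i₀ + 1 := by
    intro i hi
    obtain ⟨hi, h1, h2⟩ := Finset.mem_filter.1 hi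
    constructor
    · rintro rfl
      exact hn (hX.below hi ht h1 h2)
    · rintro rfl
      exact hn (hX.left hi h1 h2)
  -- Before `i₀` take the predecessor below, after it the one on the left.
  refine Finset.card_le_card_of_injOn (fun i => if i < i₀ then i else i - 1) ?_ ?_
  · intro i hi
    have hi' := hne i hi
    simp only [Finset.coe_filter, Set.mem_ofPred_eq] at hi
    obtain ⟨hi, h1, h2⟩ := hi
    have hm := mem_diagIndex.1 hi
    simp only [Finset.coe_filter, Set.mem_ofPred_eq, mem_diagIndex]
    split_ifs with hlt
    · exact ⟨by omega, hX.below hi (by omega) h1 h2⟩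
    · exact ⟨by omega, hX.left hi h1 h2⟩
  · intro i hi k hk hik
    have hi' := hne i hi
    have hk' := hne k hk
    simp only at hik
    split_ifs at hik <;> omega

/-- Once one side of the rectangle has been reached, the diagonals no longer get longer. -/
lemma diagCount_succ_le_of_forall {t : ℕ} (ht : w ≤ t ∨ h + 1 ≤ t)
    (hall : ∀ i ∈ diagIndex w h t, X i (t - i)) :
    diagCount w h X (t + 1) ≤ diagCount w h X t := by
  classical
  have : diagCount w h X t = (diagIndex w h t).card := by
    rw [diagCount, Finset.filter_true_of_mem hall]
  rw [this]
  refine (diagCount_le_card _ _ _ _).trans ?_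
  rcases ht with ht | ht
  · refine Finset.card_le_card fun i hi => ?_
    rw [mem_diagIndex] at hi ⊢
    omega
  · refine Finset.card_le_card_of_injOn (fun i => i - 1) ?_ ?_
    · intro i hi
      have := mem_diagIndex.1 hi
      simp only [Finset.mem_coe, mem_diagIndex]
      omega
    · intro i hi k hk hik
      have := mem_diagIndex.1 hi
      have := mem_diagIndex.1 hk
      simp only at hik
      omega

/-- Past both sides, each point has two counted predecessors, and a nonempty set of points on a
diagonal has at least one more predecessor than points. -/
lemma diagCount_succ_le_sub_one (hX : Shadow w h X P) {t : ℕ} (hw : w ≤ t) (hh : h + 1 ≤ t) :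
    diagCount w h X (t + 1) ≤ diagCount w h X t - 1 + diagCount w h P (t + 1) := by
  classical
  refine diagCount_succ_le_of_card ?_
  set Y := (diagIndex w h (t + 1)).filter fun i => X i (t + 1 - i) ∧ ¬ P i (t + 1 - i) with hY
  rcases Y.eq_empty_or_nonempty with he | hne
  · simp [he]
  have hmem : ∀ i ∈ Y, i ≤ w ∧ i ≤ t ∧ 2 ≤ i ∧ t + 1 ≤ i + h ∧ X i (t - i) ∧
      X (i - 1) (t - (i - 1)) := by
    intro i hi
    obtain ⟨hi, h1, h2⟩ := Finset.mem_filter.1 hi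
    have := mem_diagIndex.1 hi
    exact ⟨by omega, by omega, by omega, by omega, hX.below hi (by omega) h1 h2, hX.left hi h1 h2⟩
  have hsub : insert (Y.max' hne) (Y.image fun i => i - 1) ⊆
      (diagIndex w h t).filter fun i => X i (t - i) := by
    intro k hk
    rw [Finset.mem_insert, Finset.mem_image] at hk
    rw [Finset.mem_filter, mem_diagIndex]
    rcases hk with rfl | ⟨i, hi, rfl⟩
    · have := hmem _ (Y.max'_mem hne)
      exact ⟨by omega, this.2.2.2.2.1⟩
    · have := hmem _ hi
      exact ⟨by omega, this.2.2.2.2.2⟩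
  have hcard := Finset.card_le_card hsub
  rw [Finset.card_insert_of_notMem, Finset.card_image_of_injOn] at hcard
  · unfold diagCount
    omega
  · intro i hi k hk hik
    have := hmem i hi
    have := hmem k hk
    simp only at hik
    omega
  · intro hk
    obtain ⟨i, hi, hik⟩ := Finset.mem_image.1 hk
    have := Y.le_max' i hi
    have := hmem i hi
    omega

end Shadow

/-! ### Upper bound: counting unburnt vertices over four quadrants -/

/-- Four quadrants around the vertex `v`, given by coordinates `q k i j` with `i ≤ w k` and
`j ≤ h k`. The points of the `k`-th quadrant with `i = 0` are points of the next quadrant with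
`j = 0`, and apart from that the quadrants are disjoint. -/
structure QuadrantCover (G : SimpleGraph V) (v : V) (q : Fin 4 → ℕ → ℕ → V) (w h : Fin 4 → ℕ) :
    Prop where
  adj_right : ∀ k i j, i < w k → j ≤ h k → G.Adj (q k i j) (q k (i + 1) j)
  adj_up : ∀ k i j, i ≤ w k → j < h k → G.Adj (q k i j) (q k i (j + 1))
  origin : ∀ k, q k 0 0 = v
  width_succ : ∀ k, w (k + 1) = h k
  axis : ∀ k, ∀ j ≤ h k, q (k + 1) j 0 = q k 0 j
  inj : ∀ k i j k' i' j', 1 ≤ i → i ≤ w k → j ≤ h k → 1 ≤ i' → i' ≤ w k' → j' ≤ h k' →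
    q k i j = q k' i' j' → k = k' ∧ i = i' ∧ j = j'
  surj : ∀ u, u ≠ v → ∃ k i j, 1 ≤ i ∧ i ≤ w k ∧ j ≤ h k ∧ q k i j = u

namespace QuadrantCover

variable {G : SimpleGraph V} {v : V} {q : Fin 4 → ℕ → ℕ → V} {w h : Fin 4 → ℕ}

/-- The number of vertices at distance `t` from `v` not on fire at time `t`. -/
noncomputable def unburnt (G : SimpleGraph V) (v : V) (q : Fin 4 → ℕ → ℕ → V) (w h : Fin 4 → ℕ)
    (p : ℕ → V) (t : ℕ) : ℕ :=
  ∑ k, diagCount (w k) (h k) (fun i j => q k i j ∉ burning G v p (i + j)) t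

/-- The number of vertices at distance `t` from `v` protected by time `t`. -/
noncomputable def shielded (q : Fin 4 → ℕ → ℕ → V) (w h : Fin 4 → ℕ) (p : ℕ → V) (t : ℕ) : ℕ :=
  ∑ k, diagCount (w k) (h k) (fun i j => q k i j ∈ protectedSet p (i + j)) t

lemma shadow (hq : QuadrantCover G v q w h) (p : ℕ → V) (k : Fin 4) :
    Shadow (w k) (h k) (fun i j => q k i j ∉ burning G v p (i + j))
      (fun i j => q k i j ∈ protectedSet p (i + j)) := by
  constructor
  · intro i j hi hj hX
    by_contra hcon
    push Not at hcon
    refine hX ?_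
    rw [show i + 1 + j = i + j + 1 by ring] at hcon ⊢
    exact Or.inr ⟨hcon.2, _, hcon.1, hq.adj_right k i j hi hj⟩
  · intro i j hi hj hX
    by_contra hcon
    push Not at hcon
    exact hX (Or.inr ⟨hcon.2, _, hcon.1, hq.adj_up k i j hi hj⟩)

/-- The vertices counted are distinct, by `inj`, and are among the first `t` moves. -/
lemma sum_shielded_le (hq : QuadrantCover G v q w h) (p : ℕ → V) (t : ℕ) :
    ∑ s ∈ Finset.range (t + 1), shielded q w h p s ≤ t := by
  classical
  let S : Finset (Σ _ : ℕ, Σ _ : Fin 4, ℕ) := (Finset.range (t + 1)).sigma fun s =>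
    Finset.univ.sigma fun k =>
      (diagIndex (w k) (h k) s).filter fun i => q k i (s - i) ∈ protectedSet p (i + (s - i))
  have hS : ∑ s ∈ Finset.range (t + 1), shielded q w h p s = S.card := by
    simp only [S, Finset.card_sigma, shielded, diagCount]
  rw [hS]
  calc S.card ≤ ((Finset.range t).image p).card := by
        refine Finset.card_le_card_of_injOn (fun x => q x.2.1 x.2.2 (x.1 - x.2.2)) ?_ ?_
        · rintro ⟨s, k, i⟩ hx
          simp only [S, Finset.coe_sigma, Set.mem_sigma_iff, Finset.mem_coe, Finset.mem_range,
            Finset.mem_filter, mem_diagIndex] at hx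
          obtain ⟨hs, -, hi, l, hl, hpl⟩ := hx
          simp only [Finset.coe_image, Set.mem_image, Finset.mem_coe, Finset.mem_range]
          exact ⟨l, by omega, hpl⟩
        · rintro ⟨s, k, i⟩ hx ⟨s', k', i'⟩ hx' he
          simp only [S, Finset.coe_sigma, Set.mem_sigma_iff, Finset.mem_coe, Finset.mem_range,
            Finset.mem_filter, mem_diagIndex] at hx hx'
          have he : q k i (s - i) = q k' i' (s' - i') := he
          obtain ⟨rfl, rfl, h3⟩ := hq.inj _ _ _ _ _ _ (by omega) (by omega) (by omega) (by omega)
            (by omega) (by omega) he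
          have : s = s' := by omega
          rw [this]
    _ ≤ t := Finset.card_image_le.trans (Finset.card_range t).le

lemma unburnt_le_sum_shielded (hq : QuadrantCover G v q w h) (p : ℕ → V) (t : ℕ) :
    unburnt G v q w h p t ≤ ∑ s ∈ Finset.range (t + 1), shielded q w h p s := by
  classical
  induction t with
  | zero =>
    have : unburnt G v q w h p 0 = 0 := by
      refine Finset.sum_eq_zero fun k _ => ?_
      have h0 : diagIndex (w k) (h k) 0 = ∅ := by
        ext i
        simp only [mem_diagIndex, Finset.notMem_empty, iff_false]
        omega
      simp [diagCount, h0]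
    omega
  | succ t ih =>
    rw [Finset.sum_range_succ]
    refine le_trans ?_ (Nat.add_le_add_right ih _)
    unfold unburnt shielded
    rw [← Finset.sum_add_distrib]
    refine Finset.sum_le_sum fun k _ => ?_
    by_cases hex : ∃ i₀, i₀ ≤ w k ∧ i₀ ≤ t ∧ t ≤ i₀ + h k ∧
        ¬ (q k i₀ (t - i₀) ∉ burning G v p (i₀ + (t - i₀)))
    · obtain ⟨i₀, h1, h2, h3, h4⟩ := hex
      exact (hq.shadow p k).diagCount_succ_le_of_exists h1 h2 h3 h4
    push Not at hex
    by_cases ht : w k ≤ t ∨ h k + 1 ≤ t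
    · refine le_trans (Shadow.diagCount_succ_le_of_forall ht fun i hi => ?_) (Nat.le_add_right _ _)
      rw [mem_diagIndex] at hi
      exact hex i hi.2.1 hi.2.2.1 hi.2.2.2
    push Not at ht
    -- Here the diagonal of quadrant `k` would be entirely unburnt and not yet cut off by a side.
    -- Its `t` points and the axis point, owned by quadrant `k + 1`, make `t + 1` unburnt vertices
    -- in layer `t`, while the induction hypothesis allows only `t`.
    exfalso
    have h0 := hex 0 (by omega) (by omega) (by omega)
    rcases Nat.eq_zero_or_pos t with rfl | htpos
    · refine h0 ?_
      simp [hq.origin, burning]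
    have hk : t ≤ diagCount (w k) (h k) (fun i j => q k i j ∉ burning G v p (i + j)) t := by
      have hcard := card_le_diagCount (w := w k) (h := h k) (t := t) (S := Finset.Icc 1 t)
        (X := fun i j => q k i j ∉ burning G v p (i + j))
        (fun i hi => by rw [Finset.mem_Icc] at hi; rw [mem_diagIndex]; omega)
        (fun i hi => by
          rw [Finset.mem_Icc] at hi
          exact hex i (by omega) (by omega) (by omega))
      simpa using hcard
    have hk' : 1 ≤ diagCount (w (k + 1)) (h (k + 1))
        (fun i j => q (k + 1) i j ∉ burning G v p (i + j)) t := by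
      have := hq.width_succ k
      refine card_le_diagCount (S := {t}) (fun i hi => ?_) (fun i hi => ?_) <;>
        obtain rfl := Finset.mem_singleton.1 hi
      · rw [mem_diagIndex]
        omega
      · rw [Nat.sub_self, hq.axis k i (by omega)]
        simpa using h0
    have hne : k ≠ k + 1 := (by decide : ∀ k : Fin 4, k ≠ k + 1) k
    have hle : t + 1 ≤ unburnt G v q w h p t := by
      calc t + 1 ≤ _ := Nat.add_le_add hk hk'
        _ = ∑ l ∈ {k, k + 1}, diagCount (w l) (h l)
            (fun i j => q l i j ∉ burning G v p (i + j)) t := by rw [Finset.sum_pair hne]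
        _ ≤ _ := Finset.sum_le_sum_of_subset (Finset.subset_univ _)
    have := hq.sum_shielded_le p t
    omega

lemma unburnt_succ_le (hq : QuadrantCover G v q w h) (p : ℕ → V) {t : ℕ} (hw : ∀ k, w k ≤ t)
    (hh : ∀ k, h k + 1 ≤ t) :
    unburnt G v q w h p (t + 1) ≤ unburnt G v q w h p t - 1 + shielded q w h p (t + 1) := by
  have h1 : ∀ k, _ := fun k => (hq.shadow p k).diagCount_succ_le_sub_one (hw k) (hh k)
  simp only [unburnt, shielded, Fin.sum_univ_four]
  have := h1 0
  have := h1 1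
  have := h1 2
  have := h1 3
  omega

/-- With `c` shielded vertices up to layer `B`, at most `B + m - c` more are shielded up to layer `B
+ m`, while the initial at most `c` unburnt vertices lose one per step. The sum is at most `B` plus
the truncated difference `m - c`. -/
lemma unburnt_add_le (hq : QuadrantCover G v q w h) (p : ℕ → V) {B : ℕ} (hw : ∀ k, w k ≤ B)
    (hh : ∀ k, h k + 1 ≤ B) (m : ℕ) :
    unburnt G v q w h p (B + m) ≤
      B + (m - ∑ s ∈ Finset.range (B + 1), shielded q w h p s) := by
  have key : unburnt G v q w h p (B + m) + ∑ s ∈ Finset.range (B + 1), shielded q w h p s ≤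
      (unburnt G v q w h p B - m) + ∑ s ∈ Finset.range (B + m + 1), shielded q w h p s := by
    induction m with
    | zero => simp
    | succ m ih =>
      have := hq.unburnt_succ_le p (t := B + m) (fun k => (hw k).trans (Nat.le_add_right _ _))
        (fun k => (hh k).trans (Nat.le_add_right _ _))
      have hmono : ∑ s ∈ Finset.range (B + 1), shielded q w h p s ≤
          ∑ s ∈ Finset.range (B + m + 1), shielded q w h p s :=
        Finset.sum_le_sum_of_subset (Finset.range_mono (by omega))
      rw [show B + (m + 1) = B + m + 1 by ring, Finset.sum_range_succ _ (B + m + 1)]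
      omega
  have h1 := hq.unburnt_le_sum_shielded p B
  have h2 := hq.sum_shielded_le p (B + m)
  have h3 := hq.sum_shielded_le p B
  omega

/-- The bound is independent of `c`: up to layer `B` the counts are at most `min t c`, and what this
saves against `t` pays for the excess `m - c` in the later layers, because `K ≤ B`. -/
lemma sum_unburnt_le (hq : QuadrantCover G v q w h) (p : ℕ → V) {B K : ℕ} (hw : ∀ k, w k ≤ B)
    (hh : ∀ k, h k + 1 ≤ B) (hK : K ≤ B) :
    ∑ t ∈ Finset.range (B + 1 + K), unburnt G v q w h p t ≤
      ∑ t ∈ Finset.range (B + 1), t + K * B := by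
  set c := ∑ s ∈ Finset.range (B + 1), shielded q w h p s with hc
  rw [Finset.sum_range_add]
  have h1 : ∑ t ∈ Finset.range (B + 1), unburnt G v q w h p t ≤
      ∑ t ∈ Finset.range (B + 1), (t - (t - c)) := by
    refine Finset.sum_le_sum fun t ht => ?_
    have ha := hq.unburnt_le_sum_shielded p t
    have hb := hq.sum_shielded_le p t
    have hd : ∑ s ∈ Finset.range (t + 1), shielded q w h p s ≤ c :=
      Finset.sum_le_sum_of_subset (Finset.range_mono (Finset.mem_range.1 ht))
    omega
  have h2 : ∑ m ∈ Finset.range K, unburnt G v q w h p (B + 1 + m) ≤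
      K * B + ∑ m ∈ Finset.range K, (m + 1 - c) := by
    calc _ ≤ ∑ m ∈ Finset.range K, (B + (m + 1 - c)) := Finset.sum_le_sum fun m _ => by
          rw [show B + 1 + m = B + (m + 1) by ring]
          exact hq.unburnt_add_le p hw hh (m + 1)
      _ = _ := by rw [Finset.sum_add_distrib]; simp
  have h3 : ∑ m ∈ Finset.range K, (m + 1 - c) ≤ ∑ t ∈ Finset.range (B + 1), (t - c) := by
    rw [Finset.sum_range_succ' _ B]
    exact (Finset.sum_le_sum_of_subset (Finset.range_mono hK)).trans (Nat.le_add_right _ _)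
  have h4 : ∑ t ∈ Finset.range (B + 1), (t - (t - c)) + ∑ t ∈ Finset.range (B + 1), (t - c) =
      ∑ t ∈ Finset.range (B + 1), t := by
    rw [← Finset.sum_add_distrib]
    exact Finset.sum_congr rfl fun t _ => by omega
  omega

/-- All vertices beyond distance `T` are conceded; in each quadrant they fit in a triangle at the
far corner. -/
lemma sum_unburnt_tail_le (T N : ℕ) (p : ℕ → V) :
    ∑ m ∈ Finset.range N, unburnt G v q w h p (T + 1 + m) ≤
      ∑ k, ∑ m ∈ Finset.range (w k + h k - T + 1), m := by
  unfold unburnt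
  rw [Finset.sum_comm]
  refine Finset.sum_le_sum fun k _ => ?_
  have aux : ∀ c N : ℕ, ∑ m ∈ Finset.range N, (c - m) ≤ ∑ m ∈ Finset.range (c + 1), m := by
    intro c N
    rw [← Finset.sum_range_reflect (fun m => m) (c + 1)]
    simp only [Nat.add_sub_cancel]
    rcases le_total N (c + 1) with hN | hN
    · calc _ ≤ ∑ m ∈ Finset.range (c + 1), (c - m) :=
            Finset.sum_le_sum_of_subset (Finset.range_mono hN)
        _ ≤ _ := Finset.sum_le_sum fun m _ => by omega
    · rw [← Finset.sum_subset (Finset.range_mono hN)]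
      · intro m _ hm
        rw [Finset.mem_range] at hm
        omega
  refine le_trans (Finset.sum_le_sum fun m _ => ?_) (aux (w k + h k - T) N)
  refine (diagCount_le_card _ _ _ _).trans ((card_diagIndex_le _ _ _).trans ?_)
  omega

lemma ncard_saved_le_sum_unburnt [Finite V] (hq : QuadrantCover G v q w h) (p : ℕ → V) {N : ℕ}
    (hN : ∀ k, w k + h k < N) :
    (saved G v p).ncard ≤ ∑ t ∈ Finset.range N, unburnt G v q w h p t := by
  classical
  let S : Finset (Σ _ : ℕ, Σ _ : Fin 4, ℕ) := (Finset.range N).sigma fun s =>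
    Finset.univ.sigma fun k => (diagIndex (w k) (h k) s).filter
      fun i => q k i (s - i) ∉ burning G v p (i + (s - i))
  have hS : ∑ t ∈ Finset.range N, unburnt G v q w h p t = S.card := by
    simp only [S, Finset.card_sigma, unburnt, diagCount]
  rw [hS]
  have hsub : saved G v p ⊆ (S.image fun x => q x.2.1 x.2.2 (x.1 - x.2.2) : Finset V) := by
    intro u hu
    have huv : u ≠ v := by
      rintro rfl
      exact hu 0 rfl
    obtain ⟨k, i, j, h1, h2, h3, rfl⟩ := hq.surj u huv
    rw [Finset.coe_image]
    refine ⟨⟨i + j, k, i⟩, ?_, by simp⟩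
    have := hN k
    simp only [S, Finset.coe_sigma, Set.mem_sigma_iff, Finset.mem_coe, Finset.mem_range,
      Finset.mem_filter, mem_diagIndex, Finset.mem_univ, true_and, Nat.add_sub_cancel_left]
    exact ⟨by omega, by omega, hu _⟩
  calc _ ≤ _ := Set.ncard_le_ncard hsub (Finset.finite_toSet _)
    _ = _ := Set.ncard_coe_finset _
    _ ≤ _ := Finset.card_image_le

lemma sn_le [Finite V] (hq : QuadrantCover G v q w h) {B K : ℕ} (hw : ∀ k, w k ≤ B)
    (hh : ∀ k, h k + 1 ≤ B) (hK : K ≤ B) :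
    sn G v ≤ ∑ t ∈ Finset.range (B + 1), t + K * B +
      ∑ k, ∑ m ∈ Finset.range (w k + h k - (B + K) + 1), m := by
  refine csSup_le' ?_
  rintro _ ⟨p, -, rfl⟩
  have h1 := hq.ncard_saved_le_sum_unburnt p (N := B + 1 + K + B) (fun k => by
    have := hw k
    have := hh k
    omega)
  rw [Finset.sum_range_add] at h1
  have h2 := hq.sum_unburnt_le p hw hh hK
  have h3 := sum_unburnt_tail_le (G := G) (v := v) (q := q) (w := w) (h := h) (B + K) B p
  rw [show B + K + 1 = B + 1 + K by ring] at h3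
  omega

end QuadrantCover

/-! ### The quadrants of the square grid -/

/-- The vertex of the square grid with the given coordinates, which should be less than `n`. -/
def gridPoint (n : ℕ) [NeZero n] (x y : ℕ) : Fin n × Fin n := (Fin.ofNat n x, Fin.ofNat n y)

/-- The four quadrants around a vertex of the square grid, in coordinates that turn by a
right angle from one quadrant to the next. -/
def gridQuadrant (n : ℕ) [NeZero n] (a b : ℕ) : Fin 4 → ℕ → ℕ → Fin n × Fin n :=
  ![fun i j => gridPoint n (a + i) (b + j), fun i j => gridPoint n (a - j) (b + i),
    fun i j => gridPoint n (a - i) (b - j), fun i j => gridPoint n (a + j) (b - i)]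

lemma gridPoint_eq_iff {n : ℕ} [NeZero n] {x y x' y' : ℕ} (hx : x < n) (hy : y < n) (hx' : x' < n)
    (hy' : y' < n) : gridPoint n x y = gridPoint n x' y' ↔ x = x' ∧ y = y' := by
  simp [gridPoint, Prod.ext_iff, Fin.ext_iff, Nat.mod_eq_of_lt, *]

lemma gridPoint_adj {n : ℕ} [NeZero n] {x y x' y' : ℕ} (hx : x < n) (hy : y < n) (hx' : x' < n)
    (hy' : y' < n) (h : ((x + 1 = x' ∨ x' + 1 = x) ∧ y = y') ∨ ((y + 1 = y' ∨ y' + 1 = y) ∧ x = x')) :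
    (squareGrid n).Adj (gridPoint n x y) (gridPoint n x' y') := by
  simp [squareGrid_adj, gridPoint, Fin.ext_iff, Nat.mod_eq_of_lt, *]

lemma gridPoint_val {n : ℕ} [NeZero n] (u : Fin n × Fin n) : gridPoint n u.1 u.2 = u := by
  simp [gridPoint]

lemma quadrantCover_squareGrid {n : ℕ} [NeZero n] (v : Fin n × Fin n) :
    QuadrantCover (squareGrid n) v (gridQuadrant n v.1 v.2)
      ![n - 1 - v.1, n - 1 - v.2, v.1, v.2] ![n - 1 - v.2, v.1, v.2, n - 1 - v.1] := by
  have hv := gridPoint_val v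
  obtain ⟨⟨a, ha⟩, ⟨b, hb⟩⟩ := v
  simp only at hv ⊢
  constructor
  · intro k i j hi hj
    fin_cases k <;> simp [gridQuadrant] at hi hj ⊢ <;>
      exact gridPoint_adj (by omega) (by omega) (by omega) (by omega) (by omega)
  · intro k i j hi hj
    fin_cases k <;> simp [gridQuadrant] at hi hj ⊢ <;>
      exact gridPoint_adj (by omega) (by omega) (by omega) (by omega) (by omega)
  · intro k
    fin_cases k <;> simpa [gridQuadrant] using hv
  · intro k
    fin_cases k <;> rfl
  · intro k j hj
    fin_cases k <;> simp [gridQuadrant]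
  · intro k i j k' i' j' h1 h2 h3 h4 h5 h6 he
    fin_cases k <;> fin_cases k' <;> simp [gridQuadrant] at h2 h3 h5 h6 he ⊢ <;>
      rw [gridPoint_eq_iff (by omega) (by omega) (by omega) (by omega)] at he <;> omega
  · rintro u hu
    rw [← gridPoint_val u] at hu ⊢
    obtain ⟨⟨c, hc⟩, ⟨d, hd⟩⟩ := u
    simp only at hu ⊢
    rw [← hv, Ne, gridPoint_eq_iff hc hd ha hb] at hu
    by_cases h0 : a < c ∧ b ≤ d
    · refine ⟨0, c - a, d - b, by omega, ?_, ?_, ?_⟩ <;> simp [gridQuadrant]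
      · omega
      · omega
      · rw [gridPoint_eq_iff] <;> omega
    by_cases h1 : c ≤ a ∧ b < d
    · refine ⟨1, d - b, a - c, by omega, ?_, ?_, ?_⟩ <;> simp [gridQuadrant]
      · omega
      · rw [gridPoint_eq_iff] <;> omega
    by_cases h2 : c < a ∧ d ≤ b
    · refine ⟨2, a - c, b - d, by omega, ?_, ?_, ?_⟩ <;> simp [gridQuadrant]
      · rw [gridPoint_eq_iff] <;> omega
    refine ⟨3, b - d, c - a, by omega, ?_, ?_, ?_⟩ <;> simp [gridQuadrant]
    · omega
    · rw [gridPoint_eq_iff] <;> omega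

/-! ### From vertex counts to densities -/

/-- The distance to the ends of the unit interval. -/
noncomputable def unitEndDist (x : ℝ) : ℝ := min x (1 - x)

/-- The limiting proportion of vertices saved by the strategy of a bent barrier. -/
noncomputable def lowerDensity (x y : ℝ) : ℝ :=
  1 - unitEndDist x - unitEndDist y + max (unitEndDist x) (unitEndDist y) ^ 2

/-- The contribution of vertices at moderate distance to the upper bound. -/
noncomputable def nearDensity (x y : ℝ) : ℝ :=
  1 / 2 - min (unitEndDist x) (unitEndDist y) / 3 - min (unitEndDist x) (unitEndDist y) ^ 2 / 6

/-- Twice the contribution of the far vertices of one quadrant to the upper bound. -/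
noncomputable def cornerDensity (x y : ℝ) : ℝ := max 0 (1 - max x y - 2 / 3 * min x y) ^ 2

lemma mul_unitEndDist {n : ℕ} (hn : 0 < n) (a : ℝ) :
    n * unitEndDist (a / n) = min a (n - a) := by
  have : (0 : ℝ) < n := by exact_mod_cast hn
  rw [unitEndDist, mul_min_of_nonneg _ _ this.le, mul_sub, mul_div_cancel₀ _ this.ne', mul_one]

lemma endDist_bounds {n : ℕ} (i : Fin n) :
    (endDist i : ℝ) ≤ n * unitEndDist (i / n) ∧ n * unitEndDist (i / n) ≤ endDist i + 1 ∧
      n * unitEndDist (i / n) ≤ n / 2 := by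
  have hi := i.2
  rw [mul_unitEndDist (by omega)]
  have h1 : (endDist i : ℝ) = min (i : ℝ) (n - 1 - i) := by
    rw [endDist, Nat.cast_min, Nat.cast_sub (by omega), Nat.cast_sub (by omega), Nat.cast_one]
  rw [h1]
  refine ⟨min_le_min_left _ (by linarith), ?_, ?_⟩
  · rw [← min_add_add_right]
    exact min_le_min (by linarith) (by linarith)
  · rcases le_total (i : ℝ) (n - i) with h | h
    · exact (min_le_left _ _).trans (by linarith)
    · exact (min_le_right _ _).trans (by linarith)

lemma lowerDensity_le_sn {n : ℕ} (v : Fin n × Fin n) :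
    (n : ℝ) ^ 2 * lowerDensity (v.1 / n) (v.2 / n) - 2 * n ≤ sn (squareGrid n) v := by
  have hn : (0 : ℝ) ≤ n := Nat.cast_nonneg n
  obtain ⟨h1, h2, h3⟩ := endDist_bounds v.1
  obtain ⟨h4, h5, h6⟩ := endDist_bounds v.2
  have hv1 : endDist v.1 ≤ n := by have := v.1.2; simp only [endDist]; omega
  have hv2 : endDist v.2 ≤ n := by have := v.2.2; simp only [endDist]; omega
  have e1 := le_sn_endDist v
  have e2 := le_sn_endDist_swap v
  rify [hv1] at e1
  rify [hv2] at e2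
  have p1 : (0 : ℝ) ≤ endDist v.1 := Nat.cast_nonneg _
  have p2 : (0 : ℝ) ≤ endDist v.2 := Nat.cast_nonneg _
  rw [lowerDensity]
  set x := unitEndDist (v.1 / n)
  set y := unitEndDist (v.2 / n)
  set p : ℝ := (endDist v.1 : ℝ)
  set q : ℝ := (endDist v.2 : ℝ)
  -- The difference of squares is (nz - r)(nz + r), with first factor at most 1 and second at most
  -- 2nz ≤ n.
  have sq : ∀ r z : ℝ, 0 ≤ r → r ≤ n * z → n * z ≤ r + 1 → n * z ≤ n / 2 →
      (n * z) ^ 2 - n ≤ r ^ 2 := by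
    intro r z hr ha hb hc
    nlinarith
  have m1 := mul_le_mul_of_nonneg_left h1 hn
  have m2 := mul_le_mul_of_nonneg_left h4 hn
  rcases le_total x y with h | h
  · rw [max_eq_right h]
    have := sq q y p2 h4 h5 h6
    nlinarith
  · rw [max_eq_left h]
    have := sq p x p1 h1 h2 h3
    nlinarith

lemma sum_range_le_real (m : ℕ) : ((∑ t ∈ Finset.range (m + 1), t : ℕ) : ℝ) ≤
    (m : ℝ) ^ 2 / 2 + m / 2 := by
  have h := Finset.sum_range_id_mul_two (m + 1)
  rw [Nat.add_sub_cancel] at h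
  rify at h
  push_cast
  nlinarith

/-- The triangle has side about `w + h - n + m / 3`. Replacing `m` by the larger `min x y` makes the
bound depend only on the two coordinates of this quadrant, so that the four corners have equal
averages. -/
lemma corner_le {n m w h : ℕ} (hn : 0 < n) (hw : w < n) (hh : h < n) (hmw : m + w < n)
    (hmh : m + h < n) :
    ((∑ t ∈ Finset.range (w + h - (n - m + 2 * m / 3) + 1), t : ℕ) : ℝ) ≤
      (n : ℝ) ^ 2 * cornerDensity ((n - 1 - w : ℕ) / n) ((n - 1 - h : ℕ) / n) / 2 + n / 2 := by
  have hn' : (0 : ℝ) < n := by exact_mod_cast hn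
  refine (sum_range_le_real _).trans ?_
  set c := w + h - (n - m + 2 * m / 3) with hc
  set x := n - 1 - w
  set y := n - 1 - h
  have key : (c : ℝ) ≤ n * max 0 (1 - max ((x : ℝ) / n) (y / n) - 2 / 3 * min ((x : ℝ) / n) (y / n)) := by
    have h1 : 3 * c ≤ 3 * n - 3 * max x y - 2 * min x y := by omega
    have h2 : 3 * max x y + 2 * min x y ≤ 3 * n ∨ c = 0 := by omega
    rcases h2 with h2 | h2
    · have h3 : 3 * c + 3 * max x y + 2 * min x y ≤ 3 * n := by omega
      rify at h3
      rw [max_div_div_right hn'.le, min_div_div_right hn'.le]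
      calc (c : ℝ) ≤ n - max (x : ℝ) y - 2 / 3 * min (x : ℝ) y := by linarith
        _ = n * (1 - max (x : ℝ) y / n - 2 / 3 * (min (x : ℝ) y / n)) := by field_simp
        _ ≤ _ := mul_le_mul_of_nonneg_left (le_max_right _ _) hn'.le
    · rw [h2, Nat.cast_zero]
      exact mul_nonneg hn'.le (le_max_left _ _)
  have hcn : (c : ℝ) ≤ n := by exact_mod_cast (by omega : c ≤ n)
  have hc0 : (0 : ℝ) ≤ c := Nat.cast_nonneg c
  have := pow_le_pow_left₀ hc0 key 2
  rw [mul_pow] at this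
  rw [cornerDensity]
  linarith

lemma sn_le_density {n : ℕ} (v : Fin n × Fin n) :
    (sn (squareGrid n) v : ℝ) ≤ (n : ℝ) ^ 2 * (nearDensity (v.1 / n) (v.2 / n) +
      (cornerDensity (v.1 / n) (v.2 / n) + cornerDensity (v.2 / n) (v.1.rev / n) +
      cornerDensity (v.1.rev / n) (v.2.rev / n) + cornerDensity (v.2.rev / n) (v.1 / n)) / 2)
      + 4 * n := by
  have hn : 0 < n := lt_of_le_of_lt (Nat.zero_le _) v.1.2
  have hn' : (0 : ℝ) < n := by exact_mod_cast hn
  have : NeZero n := ⟨hn.ne'⟩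
  obtain ⟨h1, h2, h3⟩ := endDist_bounds v.1
  obtain ⟨h4, h5, h6⟩ := endDist_bounds v.2
  set m := min (endDist v.1) (endDist v.2) with hm
  have ha := v.1.2
  have hb := v.2.2
  have hm' : m ≤ v.1 ∧ m ≤ n - 1 - v.1 ∧ m ≤ v.2 ∧ m ≤ n - 1 - v.2 := by
    simp only [hm, endDist]; omega
  -- `n - m` is the least `B` exceeding all side lengths. Any `K ≤ B` would be admissible; this one
  -- turns B²/2 + KB into n²/2 - mn/3 - m²/6, the source of `nearDensity`.
  have key := (quadrantCover_squareGrid v).sn_le (B := n - m) (K := 2 * m / 3)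
    (by intro k; fin_cases k <;> simp <;> omega) (by intro k; fin_cases k <;> simp <;> omega)
    (by omega)
  simp only [Fin.sum_univ_four, Matrix.cons_val] at key
  have c0 := corner_le (n := n) (m := m) (w := n - 1 - v.1) (h := n - 1 - v.2) hn (by omega)
    (by omega) (by omega) (by omega)
  have c1 := corner_le (n := n) (m := m) (w := n - 1 - v.2) (h := v.1) hn (by omega)
    (by omega) (by omega) (by omega)
  have c2 := corner_le (n := n) (m := m) (w := v.1) (h := v.2) hn (by omega)
    (by omega) (by omega) (by omega)
  have c3 := corner_le (n := n) (m := m) (w := v.2) (h := n - 1 - v.1) hn (by omega)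
    (by omega) (by omega) (by omega)
  have r1 : ((v.1.rev : ℕ)) = n - 1 - v.1 := by rw [Fin.val_rev]; omega
  have r2 : ((v.2.rev : ℕ)) = n - 1 - v.2 := by rw [Fin.val_rev]; omega
  rw [show n - 1 - (n - 1 - (v.1 : ℕ)) = v.1 by omega] at c0 c3
  rw [show n - 1 - (n - 1 - (v.2 : ℕ)) = v.2 by omega] at c0 c1
  rw [r1, r2]
  have key' : (sn (squareGrid n) v : ℝ) ≤ _ := Nat.cast_le.2 key
  rw [Nat.cast_add, Nat.cast_add, Nat.cast_add, Nat.cast_add, Nat.cast_add] at key'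
  have hB := sum_range_le_real (n - m)
  have hK : ((2 * m / 3 * (n - m) : ℕ) : ℝ) ≤ 2 * m / 3 * (n - m) := by
    rw [Nat.cast_mul, Nat.cast_sub (by omega)]
    refine mul_le_mul_of_nonneg_right ?_ (sub_nonneg.2 (Nat.cast_le.2 (by omega)))
    exact Nat.cast_div_le.trans (by simp)
  rw [Nat.cast_sub (by omega : m ≤ n)] at hB
  have near : (n : ℝ) ^ 2 / 2 - m * n / 3 - (m : ℝ) ^ 2 / 6 ≤
      (n : ℝ) ^ 2 * nearDensity (v.1 / n) (v.2 / n) + n / 2 := by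
    rw [nearDensity]
    set μ := min (unitEndDist (v.1 / n)) (unitEndDist (v.2 / n)) with hμ
    have e1 : n * μ ≤ m + 1 := by
      rw [hμ, hm, mul_min_of_nonneg _ _ hn'.le, Nat.cast_min, ← min_add_add_right]
      exact min_le_min h2 h5
    have e2 : n * μ ≤ n / 2 := by
      rw [hμ, mul_min_of_nonneg _ _ hn'.le]
      exact (min_le_left _ _).trans h3
    have e3 : (m : ℝ) ≤ n * μ := by
      rw [hμ, hm, mul_min_of_nonneg _ _ hn'.le, Nat.cast_min]
      exact min_le_min h1 h4
    have e4 : (0 : ℝ) ≤ m := Nat.cast_nonneg m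
    have e5 : (n * μ) ^ 2 - 2 * (n * μ) ≤ (m : ℝ) ^ 2 := by nlinarith
    have e6 := mul_le_mul_of_nonneg_left e1 hn'.le
    nlinarith
  have hm0 : (0 : ℝ) ≤ m := Nat.cast_nonneg m
  linarith

/-! ### Riemann sums on the unit square -/

/-- The average of `F` over the lattice points of the half-open unit square. -/
noncomputable def gridAverage (F : ℝ → ℝ → ℝ) (n : ℕ) : ℝ :=
  (∑ v : Fin n × Fin n, F (v.1 / n) (v.2 / n)) / (n : ℝ) ^ 2

/-- Uniform continuity on the square; uniformity in `x` allows replacing all inner sums of a double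
sum at once. -/
lemma riemann_sum_uniform {F : ℝ → ℝ → ℝ} (hF : Continuous (Function.uncurry F)) {ε : ℝ}
    (hε : 0 < ε) : ∀ᶠ n : ℕ in atTop, ∀ x ∈ Set.Icc (0 : ℝ) 1,
      |(∑ j ∈ Finset.range n, F x (j / n)) / n - ∫ y in (0 : ℝ)..1, F x y| ≤ ε := by
  have hK : IsCompact (Set.Icc (0 : ℝ) 1 ×ˢ Set.Icc (0 : ℝ) 1) := isCompact_Icc.prod isCompact_Icc
  obtain ⟨δ, hδ, hu⟩ := Metric.uniformContinuousOn_iff.1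
    (hK.uniformContinuousOn_of_continuous hF.continuousOn) ε hε
  obtain ⟨N, hN⟩ := exists_nat_one_div_lt hδ
  filter_upwards [eventually_ge_atTop (N + 1)] with n hn x hx
  have hn' : (0 : ℝ) < n := by exact_mod_cast (by omega : 0 < n)
  have hnδ : 1 / (n : ℝ) < δ := lt_of_le_of_lt
    (one_div_le_one_div_of_le (by positivity) (by exact_mod_cast hn)) hN
  have hcont : Continuous (F x) := hF.comp (by fun_prop : Continuous fun y => (x, y))
  have hsplit := intervalIntegral.sum_integral_adjacent_intervals (μ := MeasureTheory.volume)
    (f := F x) (a := fun k : ℕ => (k : ℝ) / n) (n := n)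
    (fun k _ => hcont.intervalIntegrable _ _)
  simp only [Nat.cast_zero, zero_div, div_self hn'.ne'] at hsplit
  rw [← hsplit, Finset.sum_div, ← Finset.sum_sub_distrib]
  calc |∑ j ∈ Finset.range n, (F x (j / n) / n - ∫ y in (j / n : ℝ)..((j + 1 : ℕ) / n), F x y)|
      ≤ ∑ j ∈ Finset.range n, |F x (j / n) / n - ∫ y in (j / n : ℝ)..((j + 1 : ℕ) / n), F x y| :=
        Finset.abs_sum_le_sum_abs _ _
    _ ≤ ∑ j ∈ Finset.range n, ε / n := Finset.sum_le_sum fun j hj => ?_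
    _ = ε := by simp; field_simp
  have hj' : (j : ℝ) + 1 ≤ n := by exact_mod_cast Finset.mem_range.1 hj
  have hlen : ((j + 1 : ℕ) : ℝ) / n - j / n = 1 / n := by push_cast; ring
  have hconst : F x (j / n) / n = ∫ _ in (j / n : ℝ)..((j + 1 : ℕ) / n), F x (j / n) := by
    rw [intervalIntegral.integral_const, hlen, smul_eq_mul]; ring
  rw [hconst, ← intervalIntegral.integral_sub (by simp) (hcont.intervalIntegrable _ _)]
  have hle : (j / n : ℝ) ≤ (j + 1 : ℕ) / n := by
    have : (0 : ℝ) < 1 / n := by positivity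
    linarith
  have hb := intervalIntegral.norm_integral_le_of_norm_le_const (a := (j / n : ℝ))
    (b := (j + 1 : ℕ) / n) (C := ε) (f := fun y => F x (j / n) - F x y) (fun y hy => by
      rw [Set.uIoc_of_le hle] at hy
      have hj0 : (0 : ℝ) ≤ j / n := by positivity
      have hj1 : ((j + 1 : ℕ) : ℝ) / n ≤ 1 := by
        rw [div_le_one hn']; push_cast; exact hj'
      have := hu (x, (j / n : ℝ)) ⟨hx, hj0, by linarith⟩ (x, y)
        ⟨hx, by linarith [hy.1], by linarith [hy.2]⟩ (by
          rw [Prod.dist_eq, dist_self, max_lt_iff, Real.dist_eq, abs_lt]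
          exact ⟨hδ, by linarith [hy.2], by linarith [hy.1]⟩)
      exact this.le)
  rw [hlen, abs_of_pos (by positivity), Real.norm_eq_abs] at hb
  exact hb.trans (by rw [mul_one_div])

lemma tendsto_gridAverage {F : ℝ → ℝ → ℝ} (hF : Continuous (Function.uncurry F)) :
    Tendsto (gridAverage F) atTop (𝓝 (∫ x in (0 : ℝ)..1, ∫ y in (0 : ℝ)..1, F x y)) := by
  have hG : Continuous fun x => ∫ y in (0 : ℝ)..1, F x y :=
    intervalIntegral.continuous_parametric_intervalIntegral_of_continuous' hF 0 1
  rw [Metric.tendsto_nhds]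
  intro ε hε
  filter_upwards [riemann_sum_uniform hF (ε := ε / 3) (by positivity),
    riemann_sum_uniform (F := fun _ x => ∫ y in (0 : ℝ)..1, F x y)
      (hG.comp continuous_snd) (ε := ε / 3) (by positivity), eventually_ge_atTop 1] with n h1 h2 hn
  have hn' : (0 : ℝ) < n := by exact_mod_cast hn
  have h2 := h2 0 ⟨le_rfl, zero_le_one⟩
  have havg : gridAverage F n =
      (∑ i ∈ Finset.range n, (∑ j ∈ Finset.range n, F (i / n) (j / n)) / n) / n := by
    rw [gridAverage, Fintype.sum_prod_type, ← Finset.sum_div, div_div, ← sq]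
    congr 1
    rw [← Fin.sum_univ_eq_sum_range (fun i : ℕ => ∑ j ∈ Finset.range n, F (i / n) (j / n))]
    exact Finset.sum_congr rfl fun i _ =>
      Fin.sum_univ_eq_sum_range (fun j : ℕ => F ((i : ℕ) / n) (j / n)) n
  have h3 : |gridAverage F n - (∑ i ∈ Finset.range n, ∫ y in (0 : ℝ)..1, F (i / n) y) / n| ≤
      ε / 3 := by
    rw [havg, ← sub_div, ← Finset.sum_sub_distrib, abs_div, abs_of_pos hn', div_le_iff₀ hn']
    calc _ ≤ ∑ i ∈ Finset.range n, |(∑ j ∈ Finset.range n, F (i / n) (j / n)) / n -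
            ∫ y in (0 : ℝ)..1, F (i / n) y| := Finset.abs_sum_le_sum_abs _ _
      _ ≤ ∑ i ∈ Finset.range n, ε / 3 := Finset.sum_le_sum fun i hi => h1 _ ⟨by positivity, by
          rw [div_le_one hn']
          exact_mod_cast (Finset.mem_range.1 hi).le⟩
      _ = ε / 3 * n := by simp; ring
  rw [Real.dist_eq]
  rw [abs_le] at h2 h3
  rw [abs_lt]
  constructor <;> linarith [h2.1, h2.2, h3.1, h3.2]

/-! ### Evaluation of the three integrals -/

lemma integral_unitEndDist {g : ℝ → ℝ} (hg : Continuous g) :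
    ∫ x in (0 : ℝ)..1, g (unitEndDist x) = 2 * ∫ x in (0 : ℝ)..(1 / 2), g x := by
  have hc : Continuous fun x => g (unitEndDist x) := by
    unfold unitEndDist; fun_prop
  rw [← intervalIntegral.integral_add_adjacent_intervals (b := 1 / 2)
    (hc.intervalIntegrable _ _) (hc.intervalIntegrable _ _)]
  have h1 : ∫ x in (0 : ℝ)..(1 / 2), g (unitEndDist x) = ∫ x in (0 : ℝ)..(1 / 2), g x := by
    refine intervalIntegral.integral_congr fun x hx => ?_
    rw [Set.uIcc_of_le (by norm_num)] at hx
    simp only [unitEndDist]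
    rw [min_eq_left (by linarith [hx.2])]
  have h2 : ∫ x in (1 / 2 : ℝ)..1, g (unitEndDist x) = ∫ x in (0 : ℝ)..(1 / 2), g x := by
    have := intervalIntegral.integral_comp_sub_left (a := (1 / 2 : ℝ)) (b := 1) g 1
    rw [show (1 : ℝ) - 1 = 0 by norm_num, show (1 : ℝ) - 1 / 2 = 1 / 2 by norm_num] at this
    rw [← this]
    refine intervalIntegral.integral_congr fun x hx => ?_
    rw [Set.uIcc_of_le (by norm_num)] at hx
    simp only [unitEndDist]
    rw [min_eq_right (by linarith [hx.1])]
  rw [h1, h2]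
  ring

lemma integral_posPart_pow (a b c d : ℝ) (hd : d ≠ 0) (k : ℕ) :
    ∫ x in a..b, max 0 (c + d * x) ^ (k + 1) =
      (max 0 (c + d * b) ^ (k + 2) - max 0 (c + d * a) ^ (k + 2)) / (d * (k + 2)) := by
  have hder : ∀ x : ℝ, HasDerivAt (fun x : ℝ => max 0 x ^ (k + 2)) ((k + 2) * max 0 x ^ (k + 1)) x := by
    intro x
    rcases lt_trichotomy x 0 with h | rfl | h
    · have : (fun x : ℝ => max 0 x ^ (k + 2)) =ᶠ[𝓝 x] fun _ => 0 := by
        filter_upwards [gt_mem_nhds h] with y hy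
        rw [max_eq_left hy.le]; simp
      rw [max_eq_left h.le]
      simpa using (hasDerivAt_const x (0 : ℝ)).congr_of_eventuallyEq this
    -- At the kink the exponent `k + 2 ≥ 2` makes the function o(x).
    · rw [hasDerivAt_iff_isLittleO]
      simp only [max_self, ne_eq, Nat.add_eq_zero_iff, OfNat.ofNat_ne_zero, and_false,
        not_false_eq_true, zero_pow, sub_zero, one_ne_zero, mul_zero, smul_zero]
      have h1 : (fun x : ℝ => max 0 x ^ (k + 2)) =O[𝓝 0] fun x : ℝ => x ^ (k + 2) := by
        refine Asymptotics.IsBigO.of_bound 1 (Eventually.of_forall fun x => ?_)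
        rw [one_mul, norm_pow, norm_pow]
        refine pow_le_pow_left₀ (norm_nonneg _) ?_ _
        rw [Real.norm_eq_abs, Real.norm_eq_abs, abs_of_nonneg (le_max_left _ _)]
        exact max_le (abs_nonneg _) (le_abs_self _)
      refine h1.trans_isLittleO ?_
      simpa using Asymptotics.isLittleO_pow_pow (𝕜 := ℝ) (m := 1) (n := k + 2) (by omega)
    · have : (fun x : ℝ => max 0 x ^ (k + 2)) =ᶠ[𝓝 x] fun x => x ^ (k + 2) := by
        filter_upwards [lt_mem_nhds h] with y hy
        rw [max_eq_right hy.le]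
      rw [max_eq_right h.le]
      refine HasDerivAt.congr_of_eventuallyEq ?_ this
      simpa using hasDerivAt_pow (k + 2) x
  have hk : (k + 2 : ℝ) ≠ 0 := by positivity
  rw [intervalIntegral.integral_eq_sub_of_hasDerivAt
    (f := fun x => max 0 (c + d * x) ^ (k + 2) / (d * (k + 2))) (fun x _ => ?_)
    ((by fun_prop : Continuous fun x => max 0 (c + d * x) ^ (k + 1)).intervalIntegrable _ _)]
  · ring
  · have h1 : HasDerivAt (fun x => c + d * x) d x := by
      simpa using ((hasDerivAt_id x).const_mul d).const_add c
    have h2 := ((hder (c + d * x)).comp x h1).div_const (d * (k + 2))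
    exact h2.congr_deriv (by field_simp)

lemma integral_cubic (a b c₀ c₁ c₂ c₃ : ℝ) :
    ∫ x in a..b, (c₀ + c₁ * x + c₂ * x ^ 2 + c₃ * x ^ 3) =
      c₀ * (b - a) + c₁ * (b ^ 2 - a ^ 2) / 2 + c₂ * (b ^ 3 - a ^ 3) / 3 +
        c₃ * (b ^ 4 - a ^ 4) / 4 := by
  rw [intervalIntegral.integral_eq_sub_of_hasDerivAt
    (f := fun x => c₀ * x + c₁ * x ^ 2 / 2 + c₂ * x ^ 3 / 3 + c₃ * x ^ 4 / 4) (fun x _ => ?_)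
    ((by fun_prop : Continuous fun x => c₀ + c₁ * x + c₂ * x ^ 2 + c₃ * x ^ 3).intervalIntegrable
      _ _)]
  · ring
  · have h := ((((hasDerivAt_id x).const_mul c₀).add
      (((hasDerivAt_pow 2 x).const_mul c₁).div_const 2)).add
      (((hasDerivAt_pow 3 x).const_mul c₂).div_const 3)).add
      (((hasDerivAt_pow 4 x).const_mul c₃).div_const 4)
    refine h.congr_deriv ?_
    norm_num
    ring

lemma continuous_unitEndDist : Continuous unitEndDist := by
  unfold unitEndDist
  fun_prop

lemma integral_integral_unitEndDist {g : ℝ → ℝ → ℝ} (hg : Continuous (Function.uncurry g)) :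
    ∫ x in (0 : ℝ)..1, ∫ y in (0 : ℝ)..1, g (unitEndDist x) (unitEndDist y) =
      4 * ∫ x in (0 : ℝ)..(1 / 2), ∫ y in (0 : ℝ)..(1 / 2), g x y := by
  have hin : ∀ x, ∫ y in (0 : ℝ)..1, g (unitEndDist x) (unitEndDist y) =
      2 * ∫ y in (0 : ℝ)..(1 / 2), g (unitEndDist x) y := fun x =>
    integral_unitEndDist (hg.comp (by fun_prop : Continuous fun y => (unitEndDist x, y)))
  simp only [hin]
  rw [integral_unitEndDist (g := fun x => 2 * ∫ y in (0 : ℝ)..(1 / 2), g x y)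
    (continuous_const.mul (intervalIntegral.continuous_parametric_intervalIntegral_of_continuous'
      hg 0 (1 / 2))), intervalIntegral.integral_const_mul]
  ring

/-- Split the integral of a function that is piecewise given by `g₁` and `g₂`. -/
lemma integral_eq_add_of_eqOn {f g₁ g₂ : ℝ → ℝ} (hf : Continuous f) {a b c : ℝ} (hab : a ≤ b)
    (hbc : b ≤ c) (h₁ : ∀ x, a ≤ x → x ≤ b → f x = g₁ x) (h₂ : ∀ x, b ≤ x → x ≤ c → f x = g₂ x) :
    ∫ x in a..c, f x = (∫ x in a..b, g₁ x) + ∫ x in b..c, g₂ x := by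
  rw [← intervalIntegral.integral_add_adjacent_intervals (b := b) (hf.intervalIntegrable _ _)
    (hf.intervalIntegrable _ _)]
  congr 1
  · refine intervalIntegral.integral_congr fun x hx => ?_
    rw [Set.uIcc_of_le hab] at hx
    exact h₁ x hx.1 hx.2
  · refine intervalIntegral.integral_congr fun x hx => ?_
    rw [Set.uIcc_of_le hbc] at hx
    exact h₂ x hx.1 hx.2

lemma integral_lowerDensity :
    ∫ x in (0 : ℝ)..1, ∫ y in (0 : ℝ)..1, lowerDensity x y = 5 / 8 := by
  unfold lowerDensity
  rw [integral_integral_unitEndDist (g := fun x y => 1 - x - y + max x y ^ 2)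
    (by unfold Function.uncurry; fun_prop)]
  have hval : ∀ x ∈ Set.uIcc (0 : ℝ) (1 / 2), ∫ y in (0 : ℝ)..(1 / 2),
      (1 - x - y + max x y ^ 2) = 5 / 12 + (-1 / 2) * x + 0 * x ^ 2 + 2 / 3 * x ^ 3 := by
    intro x hx
    rw [Set.uIcc_of_le (by norm_num)] at hx
    rw [integral_eq_add_of_eqOn (b := x) (by fun_prop) hx.1 hx.2
      (g₁ := fun y => (1 - x + x ^ 2) + (-1) * y + 0 * y ^ 2 + 0 * y ^ 3)
      (g₂ := fun y => (1 - x) + (-1) * y + 1 * y ^ 2 + 0 * y ^ 3)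
      (fun y _ hy => by rw [max_eq_left hy]; ring) (fun y hy _ => by rw [max_eq_right hy]; ring),
      integral_cubic, integral_cubic]
    ring
  rw [intervalIntegral.integral_congr hval, integral_cubic]
  norm_num

lemma integral_nearDensity :
    ∫ x in (0 : ℝ)..1, ∫ y in (0 : ℝ)..1, nearDensity x y = 7 / 16 := by
  unfold nearDensity
  rw [integral_integral_unitEndDist (g := fun x y => 1 / 2 - min x y / 3 - min x y ^ 2 / 6)
    (by unfold Function.uncurry; fun_prop)]
  have hval : ∀ x ∈ Set.uIcc (0 : ℝ) (1 / 2), ∫ y in (0 : ℝ)..(1 / 2),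
      (1 / 2 - min x y / 3 - min x y ^ 2 / 6) =
        1 / 4 + (-1 / 6) * x + 1 / 12 * x ^ 2 + 1 / 9 * x ^ 3 := by
    intro x hx
    rw [Set.uIcc_of_le (by norm_num)] at hx
    rw [integral_eq_add_of_eqOn (b := x) (by fun_prop) hx.1 hx.2
      (g₁ := fun y => 1 / 2 + (-1 / 3) * y + (-1 / 6) * y ^ 2 + 0 * y ^ 3)
      (g₂ := fun y => (1 / 2 - x / 3 - x ^ 2 / 6) + 0 * y + 0 * y ^ 2 + 0 * y ^ 3)
      (fun y _ hy => by rw [min_eq_right hy]; ring) (fun y hy _ => by rw [min_eq_left hy]; ring),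
      integral_cubic, integral_cubic]
    ring
  rw [intervalIntegral.integral_congr hval, integral_cubic]
  norm_num

lemma integral_cornerDensity :
    ∫ x in (0 : ℝ)..1, ∫ y in (0 : ℝ)..1, cornerDensity x y = 1 / 10 := by
  unfold cornerDensity
  have hval : ∀ x ∈ Set.uIcc (0 : ℝ) 1, ∫ y in (0 : ℝ)..1,
      max 0 (1 - max x y - 2 / 3 * min x y) ^ 2 =
        1 / 2 * max 0 (1 + (-1) * x) ^ (2 + 1) - 1 / 6 * max 0 (1 + (-5 / 3) * x) ^ (2 + 1) := by
    intro x hx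
    rw [Set.uIcc_of_le (by norm_num)] at hx
    rw [integral_eq_add_of_eqOn (b := x) (by fun_prop) hx.1 hx.2
      (g₁ := fun y => max 0 ((1 - x) + (-2 / 3) * y) ^ (1 + 1))
      (g₂ := fun y => max 0 ((1 - 2 / 3 * x) + (-1) * y) ^ (1 + 1))
      (fun y _ hy => by rw [max_eq_left hy, min_eq_right hy]; ring_nf)
      (fun y hy _ => by rw [max_eq_right hy, min_eq_left hy]; ring_nf),
      integral_posPart_pow _ _ _ _ (by norm_num), integral_posPart_pow _ _ _ _ (by norm_num)]
    have h0 : max 0 (1 - 2 / 3 * x + (-1) * 1) = 0 := max_eq_left (by linarith [hx.1])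
    rw [h0, show 1 - x + (-2 / 3) * x = 1 + (-5 / 3) * x by ring,
      show 1 - x + (-2 / 3) * 0 = 1 + (-1) * x by ring,
      show 1 - 2 / 3 * x + (-1) * x = 1 + (-5 / 3) * x by ring]
    norm_num
    ring
  rw [intervalIntegral.integral_congr hval, intervalIntegral.integral_sub,
    intervalIntegral.integral_const_mul, intervalIntegral.integral_const_mul,
    integral_posPart_pow _ _ _ _ (by norm_num), integral_posPart_pow _ _ _ _ (by norm_num)]
  · norm_num
  · exact (by fun_prop : Continuous _).intervalIntegrable _ _
  · exact (by fun_prop : Continuous _).intervalIntegrable _ _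

lemma continuous_lowerDensity : Continuous (Function.uncurry lowerDensity) := by
  have := continuous_unitEndDist
  unfold Function.uncurry lowerDensity
  fun_prop

lemma continuous_nearDensity : Continuous (Function.uncurry nearDensity) := by
  have := continuous_unitEndDist
  unfold Function.uncurry nearDensity
  fun_prop

lemma continuous_cornerDensity : Continuous (Function.uncurry cornerDensity) := by
  unfold Function.uncurry cornerDensity
  fun_prop

/-! ### Averaging over the origin of the fire, and conclusion -/

lemma survivingRate_squareGrid (n : ℕ) :
    survivingRate (squareGrid n) = (∑ v, (sn (squareGrid n) v : ℝ) / (n : ℝ) ^ 2) / (n : ℝ) ^ 2 := by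
  simp [survivingRate, survivingRateAt, sq]

lemma gridAverage_lowerDensity_le {n : ℕ} (hn : 1 ≤ n) :
    gridAverage lowerDensity n - 2 / n ≤ survivingRate (squareGrid n) := by
  have hn' : (0 : ℝ) < n := by exact_mod_cast hn
  rw [survivingRate_squareGrid, gridAverage, le_div_iff₀ (by positivity)]
  have h : ∀ v : Fin n × Fin n, lowerDensity (v.1 / n) (v.2 / n) - 2 / n ≤
      (sn (squareGrid n) v : ℝ) / (n : ℝ) ^ 2 := by
    intro v
    rw [le_div_iff₀ (by positivity)]
    refine le_of_eq_of_le ?_ (lowerDensity_le_sn v)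
    field_simp
  refine le_of_eq_of_le ?_ (Finset.sum_le_sum fun v _ => h v)
  rw [Finset.sum_sub_distrib]
  simp
  field_simp

lemma survivingRate_le_gridAverage {n : ℕ} (hn : 1 ≤ n) :
    survivingRate (squareGrid n) ≤
      gridAverage nearDensity n + 2 * gridAverage cornerDensity n + 4 / n := by
  have hn' : (0 : ℝ) < n := by exact_mod_cast hn
  rw [survivingRate_squareGrid, gridAverage, gridAverage, div_le_iff₀ (by positivity)]
  set S := ∑ v : Fin n × Fin n, cornerDensity (v.1 / n) (v.2 / n) with hS
  have hcomm : ∀ x y, cornerDensity x y = cornerDensity y x := fun x y => by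
    rw [cornerDensity, cornerDensity, max_comm x y, min_comm x y]
  -- Reflections of the grid and the symmetry of `cornerDensity` carry each corner to the first.
  have h1 : ∑ v : Fin n × Fin n, cornerDensity (v.2 / n) (v.1.rev / n) = S :=
    Fintype.sum_equiv (Fin.revPerm.prodCongr (Equiv.refl (Fin n))) _ _ fun v => hcomm _ _
  have h2 : ∑ v : Fin n × Fin n, cornerDensity (v.1.rev / n) (v.2.rev / n) = S :=
    Fintype.sum_equiv (Fin.revPerm.prodCongr Fin.revPerm) _ _ fun v => rfl
  have h3 : ∑ v : Fin n × Fin n, cornerDensity (v.2.rev / n) (v.1 / n) = S :=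
    Fintype.sum_equiv ((Equiv.refl (Fin n)).prodCongr Fin.revPerm) _ _ fun v => hcomm _ _
  have h : ∀ v : Fin n × Fin n, (sn (squareGrid n) v : ℝ) / (n : ℝ) ^ 2 ≤
      nearDensity (v.1 / n) (v.2 / n) +
      (cornerDensity (v.1 / n) (v.2 / n) + cornerDensity (v.2 / n) (v.1.rev / n) +
      cornerDensity (v.1.rev / n) (v.2.rev / n) + cornerDensity (v.2.rev / n) (v.1 / n)) / 2
      + 4 / n := by
    intro v
    rw [div_le_iff₀ (by positivity)]
    refine (sn_le_density v).trans_eq ?_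
    field_simp
  refine (Finset.sum_le_sum fun v _ => h v).trans_eq ?_
  rw [Finset.sum_add_distrib, Finset.sum_add_distrib, ← Finset.sum_div, Finset.sum_add_distrib,
    Finset.sum_add_distrib, Finset.sum_add_distrib, h1, h2, h3, ← hS]
  simp
  field_simp
  ring

end Firefighter

theorem theorem1 :
    ∃ ε δ : ℕ → ℝ, Tendsto ε atTop (𝓝 0) ∧ Tendsto δ atTop (𝓝 0) ∧
      (∀ n : ℕ, 1 ≤ n →
        5 / 8 + ε n ≤ Firefighter.survivingRate (Firefighter.squareGrid n) ∧
        Firefighter.survivingRate (Firefighter.squareGrid n) ≤ 67243 / 105300 + δ n) ∧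
      (∀ᶠ n : ℕ in atTop, (67243 / 105300 : ℝ) + δ n < 0.6386) := by
  have hl := Firefighter.tendsto_gridAverage Firefighter.continuous_lowerDensity
  have hN := Firefighter.tendsto_gridAverage Firefighter.continuous_nearDensity
  have hC := Firefighter.tendsto_gridAverage Firefighter.continuous_cornerDensity
  rw [Firefighter.integral_lowerDensity] at hl
  rw [Firefighter.integral_nearDensity] at hN
  rw [Firefighter.integral_cornerDensity] at hC
  -- 51/80 = 7/16 + 2 · 1/10 is the limit of the upper estimate. It is smaller than 67243/105300, so
  -- this error term serves for the weaker constant too.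
  have hδ : Tendsto (fun n : ℕ => Firefighter.gridAverage Firefighter.nearDensity n +
      2 * Firefighter.gridAverage Firefighter.cornerDensity n + 4 / n - 51 / 80) atTop (𝓝 0) := by
    have := ((hN.add (hC.const_mul 2)).add (tendsto_const_div_atTop_nhds_zero_nat 4)).sub_const
      (51 / 80 : ℝ)
    norm_num at this
    exact this
  refine ⟨fun n => Firefighter.gridAverage Firefighter.lowerDensity n - 2 / n - 5 / 8, _, ?_, hδ,
    fun n hn => ⟨?_, ?_⟩, ?_⟩
  · have := (hl.sub (tendsto_const_div_atTop_nhds_zero_nat 2)).sub_const (5 / 8 : ℝ)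
    norm_num at this
    exact this
  · have := Firefighter.gridAverage_lowerDensity_le hn
    linarith
  · have := Firefighter.survivingRate_le_gridAverage hn
    linarith
  · filter_upwards [hδ.eventually_lt_const (by norm_num : (0 : ℝ) < 0.6386 - 67243 / 105300)]
      with n hn
    linarith
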